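/- Let $A$ be a finite alphabet. A class of languages over $A$ is a set $\mathcal{C}$ of subsets of $A^*$. It is a \emph{lattice} if it contains $\emptyset$ and $A^*$ and is closed under union and intersection; it is \emph{quotienting} if for all $L \in \mathcal{C}$ and $u \in A^*$ the languages $u^{-1}L = \{w \in A^* \mid uw \in L\}$ and $Lu^{-1} = \{w \in A^* \mid wu \in L\}$ belong to $\mathcal{C}$. The \emph{polynomial closure} $\mathrm{Pol}(\mathcal{C})$ is the smallest class that contains $\mathcal{C}$ and is closed under union and under marked concatenation ($K, L \in \mathrm{Pol}(\mathcal{C})$ and $a \in A$ imply $KaL \in \mathrm{Pol}(\mathcal{C})$), and $\text{co-Pol}(\mathcal{C})$ is the class of all languages $L$ such that $A^* \setminus L \in \mathrm{Pol}(\mathcal{C})$. For a class $\mathcal{D}$, \emph{$\mathcal{D}$-membership} is the problem of deciding, given a regular language $L \subseteq A^*$ (by a nondeterministic finite automaton), whether $L \in \mathcal{D}$. \textbf{Theorem.} Let $\mathcal{C}$ be a quotienting lattice of regular languages over $A$. If $\mathcal{C}$-membership is decidable, then $(\mathrm{Pol}(\mathcal{C}) \cap \text{co-Pol}(\mathcal{C}))$-membership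 is decidable. -/

import Mathlib

/-- A lattice of languages over `A`: a class (set) of languages containing the empty language
and the universal language, and closed under union and intersection. -/
structure IsLanguageLattice {A : Type*} (C : Set (Language A)) : Prop where
  bot_mem : (⊥ : Language A) ∈ C
  top_mem : (⊤ : Language A) ∈ C
  union_mem : ∀ K ∈ C, ∀ L ∈ C, K ⊔ L ∈ C
  inter_mem : ∀ K ∈ C, ∀ L ∈ C, K ⊓ L ∈ C

/-- The right quotient `L u⁻¹ = {w | w u ∈ L}`. (The left quotient `u⁻¹ L = {w | u w ∈ L}` is
`Language.leftQuotient`.) -/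
def languageRightQuotient {A : Type*} (L : Language A) (u : List A) : Language A :=
  {w : List A | w ++ u ∈ L}

/-- A quotienting lattice of regular languages over `A`: a lattice of languages, all of them
regular, that is closed under left and right quotients by words. -/
structure IsQuotientingLatticeOfRegular {A : Type*} (C : Set (Language A)) : Prop extends
    IsLanguageLattice C where
  regular : ∀ L ∈ C, L.IsRegular
  leftQuotient_mem : ∀ L ∈ C, ∀ u : List A, L.leftQuotient u ∈ C
  rightQuotient_mem : ∀ L ∈ C, ∀ u : List A, languageRightQuotient L u ∈ C

/-- Membership in the polynomial closure of `C`: the smallest class of languages that contains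
`C` and is closed under union and under marked concatenation `K, L ↦ K a L`, `a ∈ A`. -/
inductive InPol {A : Type*} (C : Set (Language A)) : Language A → Prop
  | base (L : Language A) : L ∈ C → InPol C L
  | union (K L : Language A) : InPol C K → InPol C L → InPol C (K ⊔ L)
  | markedConcat (K L : Language A) (a : A) :
      InPol C K → InPol C L → InPol C (K * ({[a]} : Language A) * L)

/-- The polynomial closure `Pol(C)`. -/
def Pol {A : Type*} (C : Set (Language A)) : Set (Language A) := {L | InPol C L}

/-- `co-Pol(C)`: the languages whose complement is in `Pol(C)`. -/
def coPol {A : Type*} (C : Set (Language A)) : Set (Language A) := {L | Lᶜ ∈ Pol C}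

/-- A finite description `(I, Δ, F)` of a nondeterministic finite automaton over `A`, whose states
are natural numbers: the lists of its initial states, of its transitions `(p, a, q)` (read `a` in
state `p`, go to state `q`), and of its accepting states. Every such triple is an automaton. -/
abbrev NFACode (A : Type*) : Type _ := List ℕ × List (ℕ × A × ℕ) × List ℕ

namespace NFACode

/-- The automaton described by a code. Only the finitely many states listed in the code matter. -/
def toNFA {A : Type*} (c : NFACode A) : NFA A ℕ where
  start := {q | q ∈ c.1}
  step p a := {q | (p, a, q) ∈ c.2.1}
  accept := {q | q ∈ c.2.2}

/-- The language accepted by the automaton described by a code. -/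
def language {A : Type*} (c : NFACode A) : Language A := c.toNFA.accepts

end NFACode

/-- Decidability of the membership problem of a class `C` of languages over `A`: there is an
algorithm that takes a regular language `L`, given by a nondeterministic finite automaton, and
tells whether `L ∈ C`. -/
def MembershipDecidable {A : Type*} [Primcodable A] (C : Set (Language A)) : Prop :=
  ComputablePred fun c : NFACode A => c.language ∈ C

/-- The codes describe exactly the regular languages. -/
theorem NFACode.isRegular_iff_exists_code {A : Type*} [Finite A] (L : Language A) :
    L.IsRegular ↔ ∃ c : NFACode A, c.language = L := by
  constructor
  · intro h
    obtain ⟨σ, hσ, M, rfl⟩ := h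
    classical
    have := Fintype.ofFinite A
    obtain ⟨n, ⟨e⟩⟩ := Finite.exists_equiv_fin σ
    let g : σ → ℕ := fun s => (e s : ℕ)
    have hg : Function.Injective g := fun a b hab => e.injective (Fin.ext hab)
    let c : NFACode A := ([g M.start],
      (Finset.univ : Finset (σ × A)).toList.map (fun x => (g x.1, x.2, g (M.step x.1 x.2))),
      ((Finset.univ : Finset σ).filter (· ∈ M.accept)).toList.map g)
    refine ⟨c, ?_⟩
    have hs : c.toNFA.start = {g M.start} := by
      ext q; simp [NFACode.toNFA, c]
    have hst : ∀ s a, c.toNFA.step (g s) a = {g (M.step s a)} := by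
      intro s a
      ext q
      simp only [NFACode.toNFA, c, Set.mem_ofPred_eq, List.mem_map, Finset.mem_toList,
        Finset.mem_univ, true_and, Prod.mk.injEq, Set.mem_singleton_iff, Prod.exists]
      constructor
      · rintro ⟨s', a', h1, rfl, rfl⟩
        rw [hg h1]
      · rintro rfl
        exact ⟨s, a, rfl, rfl, rfl⟩
    have hev : ∀ (w : List A) (s : σ), c.toNFA.evalFrom {g s} w = {g (M.evalFrom s w)} := by
      intro w
      induction w with
      | nil => intro s; simp
      | cons a w ih =>
        intro s
        rw [NFA.evalFrom_cons, NFA.stepSet_singleton, hst, ih, DFA.evalFrom_cons]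
    ext w
    rw [NFACode.language, NFA.mem_accepts, hs, hev, DFA.mem_accepts]
    simp only [Set.mem_singleton_iff, exists_eq_right, DFA.eval]
    simp only [NFACode.toNFA, c, Set.mem_ofPred_eq, List.mem_map, Finset.mem_toList,
      Finset.mem_filter, Finset.mem_univ, true_and]
    constructor
    · rintro ⟨s, h1, h2⟩
      rwa [← hg h2]
    · intro h
      exact ⟨_, h, rfl⟩
  · rintro ⟨c, rfl⟩
    rw [Language.isRegular_iff_finite_range_leftQuotient, NFACode.language,
      ← NFA.toDFA_correct, Language.leftQuotient_accepts, Set.range_comp]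
    apply Set.Finite.image
    have hfin : ({q | q ∈ c.1} ∪ {q | ∃ p a, (p, a, q) ∈ c.2.1} : Set ℕ).Finite := by
      refine Set.Finite.union (List.finite_toSet c.1) ?_
      refine ((List.finite_toSet c.2.1).image (fun x => x.2.2)).subset ?_
      rintro q ⟨p, a, h⟩
      exact ⟨_, h, rfl⟩
    refine hfin.finite_subsets.subset ?_
    rintro _ ⟨w, rfl⟩
    induction w using List.reverseRecOn with
    | nil => exact Set.subset_union_left
    | append_singleton w a _ =>
      rw [DFA.eval_append_singleton]
      intro q hq
      change q ∈ c.toNFA.stepSet _ a at hq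
      rw [NFA.mem_stepSet] at hq
      obtain ⟨p, _, hp⟩ := hq
      exact Or.inr ⟨p, a, hp⟩

/-! ### Products in Pol(C), and covers of languages value by value -/

section PolynomialClosure

variable {A : Type*}

/-! The core is an algebraic criterion (`mem_Pol_inter_coPol_iff`): a regular language L lies in
Pol(C) ∩ co-Pol(C) exactly when, for every idempotent e of its syntactic monoid, the local
stabilizer {w | e w e = e} lies in C. Decidability follows: finitely many words represent all
syntactic classes, automata for the stabilizers can be computed from them, and C-membership is
queried for each.

Sufficiency. For the syntactic morphism α, each α⁻¹(m) is shown to be in Pol(C) by building A* from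
letters with rational operations. The invariant is `PolCoverable`: the words of value m are covered
by a language of Pol(C) with the single value m. The cover may leave the given language, which makes
the star tractable. If all words of H have an idempotent value e and Z is a cover of H of value e,
then H* ⊆ 1 ∪ Z ∪ Z U Z with U the stabilizer of e, and Z U Z still has value e.
`PolCoverable.kstar` reduces every star to this case. Both L and its complement are unions of sets
α⁻¹(m).

Necessity. For K in Pol(C) there is a finite D ⊆ C such that, in a word of K, a long power of a word
idempotent up to `ContextLE D` tolerates the insertion of any larger word
(`InPol.exists_insertion`). Applied to L and to its complement with powers of e w e, this makes each
stabilizer upward closed for some `ContextLE D`, hence a finite union of finite intersections of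
quotients of members of C (`mem_of_contextLE_closed`). -/

theorem InPol.of_iff {C : Set (Language A)} {K L : Language A} (hK : InPol C K)
    (h : ∀ w, w ∈ K ↔ w ∈ L) : InPol C L :=
  (Language.ext h : K = L) ▸ hK

/-- For L in C, splitting on the first letter of the right factor makes K L the union of the
languages K a (a⁻¹L), together with K if L contains the empty word. The other cases are
distributivity and associativity. -/
theorem InPol.mul [Finite A] {C : Set (Language A)} (hC : IsQuotientingLatticeOfRegular C)
    {K L : Language A} (hK : InPol C K) (hL : InPol C L) : InPol C (K * L) := by
  induction hL with
  | base L hL =>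
    have key : ∀ s : Set A, s.Finite →
        InPol C {w | ([] ∈ L ∧ w ∈ K) ∨ ∃ a ∈ s, w ∈ K * ({[a]} : Language A) *
          L.leftQuotient [a]} := by
      intro s hs
      induction s, hs using Set.Finite.induction_on with
      | empty =>
        by_cases h : [] ∈ L
        · refine hK.of_iff fun w => ?_
          change _ ↔ (_ ∨ _)
          simp [h]
        · refine (InPol.base _ hC.bot_mem).of_iff fun w => ?_
          change False ↔ (_ ∨ _)
          simp [h]
      | @insert a s _ _ ih =>
        refine (InPol.union _ _ ih (.markedConcat K _ a hK
          (.base _ (hC.leftQuotient_mem L hL [a])))).of_iff fun w => ?_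
        change (_ ∨ _) ∨ _ ↔ (_ ∨ _)
        simp only [Set.mem_insert_iff, exists_eq_or_imp]
        exact or_assoc.trans (or_congr_right or_comm)
    refine (key Set.univ Set.finite_univ).of_iff fun w => ?_
    change (_ ∨ _) ↔ _
    simp only [Language.mem_mul, Set.mem_univ, true_and]
    symm
    constructor
    · rintro ⟨u, hu, v, hv, rfl⟩
      cases v with
      | nil => exact Or.inl ⟨hv, by simpa using hu⟩
      | cons a v => exact Or.inr ⟨a, u ++ [a], ⟨u, hu, [a], rfl, rfl⟩, v, hv, by simp⟩
    · rintro (⟨h, hw⟩ | ⟨a, _, ⟨u, hu, _, rfl, rfl⟩, v, hv, rfl⟩)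
      · exact ⟨w, hw, [], h, by simp⟩
      · exact ⟨u, hu, a :: v, hv, by simp⟩
  | union L₁ L₂ _ _ h₁ h₂ =>
    have : K * (L₁ ⊔ L₂) = K * L₁ ⊔ K * L₂ := mul_add K L₁ L₂
    exact this ▸ .union _ _ h₁ h₂
  | markedConcat L₁ L₂ a _ h₂ h₁ _ =>
    have : K * (L₁ * ({[a]} : Language A) * L₂) = K * L₁ * {[a]} * L₂ := by
      simp only [mul_assoc]
    exact this ▸ .markedConcat _ _ a h₁ h₂

/-- A monoid morphism from the words over `A` to `M`. -/
structure WordMorphism (A M : Type*) [Monoid M] where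
  toFun : List A → M
  map_nil : toFun [] = 1
  map_append : ∀ u v, toFun (u ++ v) = toFun u * toFun v

instance {M : Type*} [Monoid M] : CoeFun (WordMorphism A M) fun _ => List A → M :=
  ⟨WordMorphism.toFun⟩

variable {M : Type*} [Monoid M]

/-- The words of `H` with value `m` are covered by a language of `Pol(C)` of words with
value `m`, for each `m`. -/
def PolCoverable (C : Set (Language A)) (α : WordMorphism A M) (H : Language A) : Prop :=
  ∀ m : M, ∃ Z : Language A, InPol C Z ∧ (∀ w ∈ H, α w = m → w ∈ Z) ∧ ∀ w ∈ Z, α w = m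

namespace PolCoverable

variable {C : Set (Language A)} {α : WordMorphism A M} {H K : Language A}

theorem mono (hK : PolCoverable C α K) (h : H ≤ K) : PolCoverable C α H := fun m => by
  obtain ⟨Z, hZ, h₁, h₂⟩ := hK m
  exact ⟨Z, hZ, fun w hw => h₁ w (h hw), h₂⟩

theorem zero (hC : IsQuotientingLatticeOfRegular C) : PolCoverable C α 0 := fun _ =>
  ⟨⊥, .base _ hC.bot_mem, fun _ hw => hw.elim, fun _ hw => hw.elim⟩

theorem add (hH : PolCoverable C α H) (hK : PolCoverable C α K) : PolCoverable C α (H + K) := by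
  intro m
  obtain ⟨Y, hY, h₁, h₂⟩ := hH m
  obtain ⟨Z, hZ, h₃, h₄⟩ := hK m
  refine ⟨Y ⊔ Z, .union _ _ hY hZ, ?_, ?_⟩
  · rintro w (hw | hw) h
    · exact Or.inl (h₁ w hw h)
    · exact Or.inr (h₃ w hw h)
  · rintro w (hw | hw)
    · exact h₂ w hw
    · exact h₄ w hw

theorem biUnion (hC : IsQuotientingLatticeOfRegular C) {ι : Type*} {s : Set ι} (hs : s.Finite)
    {H : ι → Language A} (h : ∀ i ∈ s, PolCoverable C α (H i)) :
    PolCoverable C α {w | ∃ i ∈ s, w ∈ H i} := by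
  induction s, hs using Set.Finite.induction_on with
  | empty =>
    refine (zero hC).mono ?_
    rintro w ⟨_, hi, _⟩
    exact hi.elim
  | @insert i s _ _ ih =>
    refine ((h i (Set.mem_insert ..)).add
      (ih fun j hj => h j (Set.mem_insert_of_mem _ hj))).mono ?_
    rintro w ⟨j, rfl | hj, hw⟩
    · exact Or.inl hw
    · exact Or.inr ⟨j, hj, hw⟩

theorem of_inPol {m : M} (hC : IsQuotientingLatticeOfRegular C) (hH : InPol C H)
    (h : ∀ w ∈ H, α w = m) : PolCoverable C α H := by
  intro n
  by_cases hn : n = m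
  · subst hn
    exact ⟨H, hH, fun w hw _ => hw, h⟩
  · exact ⟨⊥, .base _ hC.bot_mem, fun w hw hw' => (hn (hw'.symm.trans (h w hw))).elim,
      fun _ hw => hw.elim⟩

theorem mul [Finite A] [Finite M] (hC : IsQuotientingLatticeOfRegular C)
    (hH : PolCoverable C α H) (hK : PolCoverable C α K) : PolCoverable C α (H * K) := by
  choose Y hY h₁ h₂ using hH
  choose Z hZ h₃ h₄ using hK
  refine (biUnion hC (s := (Set.univ : Set (M × M))) Set.finite_univ
    (H := fun p => Y p.1 * Z p.2) fun p _ => of_inPol (m := p.1 * p.2) hC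
      ((hY p.1).mul hC (hZ p.2)) ?_).mono ?_
  · rintro _ ⟨u, hu, v, hv, rfl⟩
    change α (u ++ v) = _
    rw [α.map_append, h₂ _ u hu, h₄ _ v hv]
  · rintro _ ⟨u, hu, v, hv, rfl⟩
    exact ⟨(α u, α v), trivial, u, h₁ _ u hu rfl, v, h₃ _ v hv rfl, rfl⟩

open scoped Computability

/-- For each idempotent `e`, the words `w` with `e * α w * e = e` form a language of `C`. -/
def _root_.LocalStabilizersMem (C : Set (Language A)) (α : WordMorphism A M) : Prop :=
  ∀ e : M, e * e = e → ({w | e * α w * e = e} : Language A) ∈ C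

theorem one (hC : IsQuotientingLatticeOfRegular C)
    (hU : LocalStabilizersMem C α) :
    PolCoverable C α 1 := by
  refine (of_inPol (m := 1) hC (.base _ (hU 1 (mul_one 1))) ?_).mono ?_
  · intro w (hw : 1 * α w * 1 = 1)
    simpa using hw
  · rintro w (rfl : w = [])
    change 1 * α [] * 1 = 1
    simp [α.map_nil]

/-- The stabilizer of the idempotent 1 is α⁻¹(1); putting it on both sides of the letter keeps the
value. -/
theorem singleton (hC : IsQuotientingLatticeOfRegular C)
    (hU : LocalStabilizersMem C α) (a : A) :
    PolCoverable C α {[a]} := by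
  have h1 : InPol C {w | 1 * α w * 1 = 1} := .base _ (hU 1 (mul_one 1))
  refine (of_inPol (m := α [a]) hC (.markedConcat _ _ a h1 h1) ?_).mono ?_
  · rintro _ ⟨_, ⟨u, hu, _, rfl, rfl⟩, v, hv, rfl⟩
    have hu : 1 * α u * 1 = 1 := hu
    have hv : 1 * α v * 1 = 1 := hv
    rw [one_mul, mul_one] at hu hv
    change α (u ++ [a] ++ v) = _
    rw [α.map_append, α.map_append, hu, hv, one_mul, mul_one]
  · rintro w (rfl : w = [a])
    have h : ([] : List A) ∈ ({w | 1 * α w * 1 = 1} : Language A) := by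
      change 1 * α [] * 1 = 1
      simp [α.map_nil]
    exact ⟨[a], ⟨[], h, [a], rfl, rfl⟩, [], h, rfl⟩

/-- A product of at least two words of H starts and ends in Z, and whatever lies between stabilizes
e. So Z U Z absorbs all long products without changing the value. -/
theorem kstar_of_idempotent [Finite A] [Finite M] (hC : IsQuotientingLatticeOfRegular C)
    (hU : LocalStabilizersMem C α)
    {e : M} (he : e * e = e) (hH : PolCoverable C α H)
    (h : ∀ w ∈ H, α w = e) : PolCoverable C α H∗ := by
  obtain ⟨Z, hZ, h₁, h₂⟩ := hH e
  have hval : ∀ w ∈ H∗, e * α w * e = e := by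
    intro w hw
    obtain ⟨l, rfl, hl⟩ := Language.mem_kstar.1 hw
    clear hw
    induction l with
    | nil => simp [α.map_nil, he]
    | cons x l ih =>
      rw [List.flatten_cons, α.map_append, h x (hl x (by simp)), ← mul_assoc, he]
      exact ih fun y hy => hl y (by simp [hy])
  have hZc : PolCoverable C α Z := of_inPol hC hZ h₂
  let U : Language A := {w | e * α w * e = e}
  have hZUZ : PolCoverable C α (Z * U * Z) := by
    refine of_inPol (m := e) hC ((hZ.mul hC (.base _ (hU e he))).mul hC hZ) ?_
    rintro _ ⟨_, ⟨u, hu, v, hv, rfl⟩, w, hw, rfl⟩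
    change α (u ++ v ++ w) = e
    rw [α.map_append, α.map_append, h₂ u hu, h₂ w hw]
    exact hv
  refine (((one hC hU).add hZc).add hZUZ).mono ?_
  have hHZ : ∀ w ∈ H, w ∈ Z := fun w hw => h₁ w hw (h w hw)
  intro w hw
  rw [← one_add_mul_kstar] at hw
  obtain hw | ⟨x, hx, v, hv, rfl⟩ := hw
  · exact Or.inl (Or.inl hw)
  · rw [← one_add_kstar_mul] at hv
    obtain hv | ⟨v, hv, y, hy, rfl⟩ := hv
    · obtain rfl : v = [] := hv
      have : x ++ [] ∈ Z := by simpa using hHZ x hx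
      exact Or.inl (Or.inr this)
    · refine Or.inr ⟨x ++ v, ⟨x, hHZ x hx, v, hval v hv, rfl⟩, y, hHZ y hy, ?_⟩
      exact List.append_assoc ..

end PolCoverable

end PolynomialClosure

/-! ### Covering arbitrary stars, and sufficiency of the criterion -/

section PolynomialClosure

open scoped Computability

variable {A : Type*} {M : Type*} [Monoid M]

namespace WordMorphism

/-- Nonempty products of words of `X`, read from `g` to `h` in the right Cayley graph of `M`,
with all intermediate vertices in `P`. -/
inductive Path (α : WordMorphism A M) (X : Language A) (P : Set M) : M → M → List A → Prop
  | single {g : M} {x : List A} : x ∈ X → Path α X P g (g * α x) x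
  | trans {g q h : M} {u v : List A} : Path α X P g q u → q ∈ P → Path α X P q h v →
      Path α X P g h (u ++ v)

/-- The labels of the paths from `g` to `h` with intermediate vertices in `P`. -/
def paths (α : WordMorphism A M) (X : Language A) (P : Set M) (g h : M) : Language A :=
  {w | Path α X P g h w}

variable {α : WordMorphism A M} {X : Language A} {P : Set M}

theorem Path.mul_eq {g h : M} {w : List A} (p : Path α X P g h w) : g * α w = h := by
  induction p with
  | single => rfl
  | trans _ _ _ h₁ h₂ => rw [α.map_append, ← mul_assoc, h₁, h₂]

theorem Path.value_mem {S : Set M} (hS : ∀ s ∈ S, ∀ t ∈ S, s * t ∈ S) (hX : ∀ x ∈ X, α x ∈ S)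
    {g h : M} {w : List A} (p : Path α X P g h w) : α w ∈ S := by
  induction p with
  | single hx => exact hX _ hx
  | trans _ _ _ h₁ h₂ => exact α.map_append _ _ ▸ hS _ h₁ _ h₂

theorem paths_empty_le (g h : M) : α.paths X ∅ g h ≤ X := by
  intro w (p : Path α X ∅ g h w)
  cases p with
  | single hx => exact hx
  | trans _ hq _ => exact hq.elim

theorem paths_mul_le {g q h : M} (hq : q ∈ P) :
    α.paths X P g q * α.paths X P q h ≤ α.paths X P g h := by
  rintro _ ⟨u, hu, v, hv, rfl⟩
  exact Path.trans hu hq hv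

/-- Kleene's elimination of the vertex q. Since paths are composed as binary trees, the point is
that the right-hand side is stable under concatenation at any vertex of `insert q P`. -/
theorem paths_insert_le (q g h : M) : α.paths X (insert q P) g h ≤
    α.paths X P g h + α.paths X P g q * (α.paths X P q q)∗ * α.paths X P q h := by
  intro w (p : Path α X (insert q P) g h w)
  induction p with
  | single hx => exact Or.inl (Path.single hx)
  | @trans g r h u v _ hr _ hu hv =>
    suffices (α.paths X P g r + α.paths X P g q * (α.paths X P q q)∗ * α.paths X P q r) *
        (α.paths X P r h + α.paths X P r q * (α.paths X P q q)∗ * α.paths X P q h) ≤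
        α.paths X P g h + α.paths X P g q * (α.paths X P q q)∗ * α.paths X P q h from
      this ⟨u, hu, v, hv, rfl⟩
    rcases hr with rfl | hr
    · set R := α.paths X P r r
      set I := α.paths X P g r
      set F := α.paths X P r h
      have h₁ : I + I * R∗ * R ≤ I * R∗ := by
        refine add_le ?_ ?_
        · exact le_mul_of_one_le_right' one_le_kstar
        · rw [mul_assoc]; gcongr; exact kstar_mul_le_kstar
      have h₂ : F + R * R∗ * F ≤ R∗ * F := by
        refine add_le ?_ ?_
        · exact le_mul_of_one_le_left' one_le_kstar
        · gcongr; exact mul_kstar_le_kstar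
      calc _ ≤ (I * R∗) * (R∗ * F) := mul_le_mul' h₁ h₂
        _ = I * (R∗ * R∗) * F := by simp only [mul_assoc]
        _ = I * R∗ * F := by rw [kstar_mul_kstar]
        _ ≤ _ := le_add_self
    · have e₁ := paths_mul_le (α := α) (X := X) (g := g) (h := h) hr
      have e₂ := paths_mul_le (α := α) (X := X) (g := g) (h := q) hr
      have e₃ := paths_mul_le (α := α) (X := X) (g := q) (h := h) hr
      have e₄ := paths_mul_le (α := α) (X := X) (g := q) (h := q) hr
      set R := α.paths X P q q
      have e₅ : R∗ * R * R∗ ≤ R∗ := by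
        calc R∗ * R * R∗ ≤ R∗ * R∗ := by gcongr; exact kstar_mul_le_kstar
          _ = R∗ := kstar_mul_kstar R
      set I := α.paths X P g q
      set F := α.paths X P q h
      set G := α.paths X P r q
      set H := α.paths X P q r
      rw [add_mul, mul_add, mul_add]
      refine add_le (add_le ?_ ?_) (add_le ?_ ?_)
      · exact e₁.trans le_self_add
      · refine le_trans ?_ le_add_self
        calc _ = (α.paths X P g r * G) * R∗ * F := by simp only [mul_assoc]
          _ ≤ I * R∗ * F := by gcongr
      · refine le_trans ?_ le_add_self
        calc _ = I * R∗ * (H * α.paths X P r h) := by simp only [mul_assoc]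
          _ ≤ I * R∗ * F := by gcongr
      · refine le_trans ?_ le_add_self
        calc _ = I * (R∗ * (H * G) * R∗) * F := by simp only [mul_assoc]
          _ ≤ I * (R∗ * R * R∗) * F := by gcongr
          _ ≤ I * R∗ * F := by gcongr

theorem kstar_le_paths (h : M) :
    ∀ w ∈ X∗, w ∈ (1 : Language A) ∨ Path α X Set.univ h (h * α w) w := by
  intro w hw
  obtain ⟨l, rfl, hl⟩ := Language.mem_kstar.1 hw
  clear hw
  induction l generalizing h with
  | nil => exact Or.inl rfl
  | cons x l ih =>
    right
    rw [List.flatten_cons]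
    have hx : Path α X Set.univ h (h * α x) x := .single (hl x (by simp))
    obtain h1 | h1 := ih (h * α x) fun y hy => hl y (by simp [hy])
    · rw [show l.flatten = [] from h1, List.append_nil]
      exact hx
    · have := hx.trans trivial h1
      rwa [mul_assoc, ← α.map_append] at this

end WordMorphism

namespace PolCoverable

variable {C : Set (Language A)} {α : WordMorphism A M} {X : Language A}

/-- The star of a coverable language whose values all act transitively on `S` by left
multiplication. -/
theorem kstar_of_image_eq [Finite A] [Finite M] (hC : IsQuotientingLatticeOfRegular C)
    (hU : LocalStabilizersMem C α) (hX : PolCoverable C α X) {S : Set M}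
    (hS : ∀ s ∈ S, ∀ t ∈ S, s * t ∈ S) (hXS : ∀ x ∈ X, α x ∈ S)
    (hb : ∀ x ∈ X, (α x * ·) '' S = S) : PolCoverable C α X∗ := by
  -- T is a submonoid containing the values of X, so it contains every vertex reachable from 1. By
  -- finiteness its elements act injectively on S.
  let T : Set M := {q | (q * ·) '' S = S}
  have hT1 : (1 : M) ∈ T := by simp [T]
  have hTmul : ∀ q ∈ T, ∀ r ∈ T, q * r ∈ T := by
    intro q (hq : _ '' _ = _) r (hr : _ '' _ = _)
    change _ '' _ = _
    conv_rhs => rw [← hq, ← hr, Set.image_image]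
    simp only [mul_assoc]
  have hTX : ∀ {P : Set M} {g h : M} {w : List A}, α.Path X P g h w → α w ∈ T := fun p =>
    p.value_mem hTmul hb
  have hinj : ∀ q ∈ T, Set.InjOn (q * ·) S := fun q (hq : _ '' _ = _) =>
    Set.injOn_of_ncard_image_eq (by rw [hq]) (Set.toFinite S)
  have hpaths : ∀ P : Set M, ∀ g ∈ T, ∀ h, PolCoverable C α (α.paths X P g h) := by
    intro P
    induction P, P.toFinite using Set.Finite.induction_on with
    | empty => exact fun g _ h => hX.mono (WordMorphism.paths_empty_le g h)
    | @insert q P _ _ ih =>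
      intro g hg h
      refine mono ?_ (WordMorphism.paths_insert_le q g h)
      refine (ih g hg h).add ?_
      -- A vertex outside T is unreachable from g, so it contributes no path.
      by_cases hq : q ∈ T
      · refine ((ih g hg q).mul hC ?_).mul hC (ih q hq h)
        by_cases hne : ∃ w, α.Path X P q q w
        · obtain ⟨w, hw⟩ := hne
          have hval : ∀ v, α.Path X P q q v → α v = α w := fun v hv =>
            hinj q hq (hv.value_mem hS hXS) (hw.value_mem hS hXS)
              (hv.mul_eq.trans hw.mul_eq.symm)
          -- All loops at q have one value: their values lie in S and fix q on the right, and left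
          -- multiplication by q is injective on S. The square of this value also fixes q, hence
          -- equals it.
          refine kstar_of_idempotent hC hU (e := α w) ?_ (ih q hq q) hval
          rw [← α.map_append]
          by_cases hqP : q ∈ P
          · exact hval _ (hw.trans hqP hw)
          · have hwS := hw.value_mem hS hXS
            refine hinj q hq ?_ hwS ?_
            · rw [α.map_append]; exact hS _ hwS _ hwS
            · change q * _ = q * _
              rw [α.map_append, ← mul_assoc, hw.mul_eq, hw.mul_eq]
        · have : α.paths X P q q ≤ 1 := fun v hv => (hne ⟨v, hv⟩).elim
          rw [kstar_eq_one.2 this]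
          exact one hC hU
      · refine (zero hC).mono ?_
        rintro _ ⟨_, ⟨u, hu, _, _, rfl⟩, _⟩
        have hu : α.Path X P g q u := hu
        exact (hq (hu.mul_eq ▸ hTmul _ hg _ (hTX hu))).elim
  refine ((one hC hU).add (biUnion hC Set.finite_univ fun h (_ : h ∈ Set.univ) =>
    hpaths Set.univ 1 hT1 h)).mono ?_
  intro w hw
  obtain h | h := WordMorphism.kstar_le_paths (α := α) 1 w hw
  · exact Or.inl h
  · exact Or.inr ⟨_, trivial, h⟩

/-- Lexicographic induction on the size of a semigroup S containing the values, then on the number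
of values. If a value x does not permute S, let B be the words of value x and Y the others, and use
X* = Y*(BY*)*. There are fewer values in Y, and products of two words of BY* have values in the
smaller semigroup xS. -/
theorem kstar [Finite A] [Finite M] (hC : IsQuotientingLatticeOfRegular C)
    (hU : LocalStabilizersMem C α) (hX : PolCoverable C α X) : PolCoverable C α X∗ := by
  suffices ∀ n k : ℕ, ∀ (S : Set M) (X : Language A), S.ncard = n →
      (α '' (X : Set (List A))).ncard = k → (∀ s ∈ S, ∀ t ∈ S, s * t ∈ S) →
      (∀ x ∈ X, α x ∈ S) → PolCoverable C α X → PolCoverable C α X∗ from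
    this _ _ Set.univ X rfl rfl (fun _ _ _ _ => trivial) (fun _ _ => trivial) hX
  intro n
  induction n using Nat.strong_induction_on with | _ n ihn
  intro k
  induction k using Nat.strong_induction_on with | _ k ihk
  intro S X hn hk hS hXS hX
  by_cases hb : ∀ x ∈ X, (α x * ·) '' S = S
  · exact kstar_of_image_eq hC hU hX hS hXS hb
  push Not at hb
  obtain ⟨x, hx, hxS⟩ := hb
  let Y : Language A := {w | w ∈ X ∧ α w ≠ α x}
  let B : Language A := {w | w ∈ X ∧ α w = α x}
  have hYX : Y ≤ X := fun w hw => hw.1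
  have hBX : B ≤ X := fun w hw => hw.1
  have hY : PolCoverable C α Y∗ := by
    refine ihk _ ?_ S Y hn rfl hS (fun y hy => hXS y hy.1) (hX.mono hYX)
    rw [← hk]
    refine Set.ncard_lt_ncard ⟨Set.image_mono hYX, fun h => ?_⟩ (Set.toFinite _)
    obtain ⟨y, hy, hyx⟩ := h ⟨x, hx, rfl⟩
    exact hy.2 hyx
  have hZ : PolCoverable C α (B * Y∗) := (hX.mono hBX).mul hC hY
  -- The empty word has value 1, possibly outside S, so values of Y* are only known to multiply S
  -- into S.
  have hYS : ∀ y ∈ Y∗, ∀ s ∈ S, α y * s ∈ S := by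
    intro y hy
    obtain ⟨l, rfl, hl⟩ := Language.mem_kstar.1 hy
    clear hy
    induction l with
    | nil => intro s hs; simpa [α.map_nil] using hs
    | cons z l ih =>
      intro s hs
      rw [List.flatten_cons, α.map_append, mul_assoc]
      exact hS _ (hXS z (hl z (by simp)).1) _ (ih (fun y hy => hl y (by simp [hy])) s hs)
  have hYS' : ∀ y ∈ Y∗, ∀ s ∈ S, s * α y ∈ S := by
    intro y hy
    obtain ⟨l, rfl, hl⟩ := Language.mem_kstar.1 hy
    clear hy
    induction l with
    | nil => intro s hs; simpa [α.map_nil] using hs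
    | cons z l ih =>
      intro s hs
      rw [List.flatten_cons, α.map_append, ← mul_assoc]
      exact ih (fun y hy => hl y (by simp [hy])) _ (hS _ hs _ (hXS z (hl z (by simp)).1))
  have hxs : α x ∈ S := hXS x hx
  have hsub : (α x * ·) '' S ⊆ S := by
    rintro _ ⟨s, hs, rfl⟩
    exact hS _ hxs _ hs
  -- One factor BY* could have value x, which need not be in xS. Two factors give x(y x y') with y x
  -- y' in S.
  have hZZ : PolCoverable C α ((B * Y∗) * (B * Y∗))∗ := by
    refine ihn _ ?_ _ ((α x * ·) '' S) _ rfl rfl ?_ ?_ (hZ.mul hC hZ)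
    · rw [← hn]
      exact Set.ncard_lt_ncard (hsub.ssubset_of_ne hxS) (Set.toFinite _)
    · rintro _ ⟨s, hs, rfl⟩ _ ⟨t, ht, rfl⟩
      exact ⟨s * (α x * t), hS _ hs _ (hS _ hxs _ ht), by simp only [mul_assoc]⟩
    · rintro _ ⟨_, ⟨b, hb, y, hy, rfl⟩, _, ⟨b', hb', y', hy', rfl⟩, rfl⟩
      refine ⟨α y * (α x * α y'), hYS y hy _ (hYS' y' hy' _ hxs), ?_⟩
      change _ = α ((b ++ y) ++ (b' ++ y'))
      simp only [α.map_append, hb.2, hb'.2, mul_assoc]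
  have hZs : PolCoverable C α (B * Y∗)∗ := by
    -- Z* = (1 + Z)(ZZ)*, by the parity of the number of factors.
    refine (((one hC hU).add hZ).mul hC hZZ).mono ?_
    generalize B * Y∗ = Z
    refine kstar_le_of_mul_le_right ?_ ?_
    · calc (1 : Language A) = 1 * 1 := (one_mul 1).symm
        _ ≤ (1 + Z) * (Z * Z)∗ := mul_le_mul' le_self_add one_le_kstar
    · rw [← mul_assoc, mul_add, mul_one, add_mul, add_mul, one_mul]
      refine add_le le_add_self ?_
      exact mul_kstar_le_kstar.trans le_self_add
  refine (hY.mul hC hZs).mono ?_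
  have hXYB : X ≤ B + Y := fun w hw => by
    by_cases h : α w = α x
    · exact Or.inl ⟨hw, h⟩
    · exact Or.inr ⟨hw, h⟩
  refine kstar_le_of_mul_le_right ?_ ?_
  · calc (1 : Language A) = 1 * 1 := (one_mul 1).symm
      _ ≤ Y∗ * (B * Y∗)∗ := mul_le_mul' one_le_kstar one_le_kstar
  · calc X * (Y∗ * (B * Y∗)∗) ≤ (B + Y) * (Y∗ * (B * Y∗)∗) := by gcongr
      _ = (B * Y∗) * (B * Y∗)∗ + Y * Y∗ * (B * Y∗)∗ := by rw [add_mul]; simp only [mul_assoc]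
      _ ≤ 1 * (B * Y∗)∗ + Y∗ * (B * Y∗)∗ := by
        rw [one_mul]
        exact add_le_add mul_kstar_le_kstar (mul_le_mul' mul_kstar_le_kstar le_rfl)
      _ ≤ Y∗ * (B * Y∗)∗ := add_le (mul_le_mul' one_le_kstar le_rfl) le_rfl

theorem top [Finite A] [Finite M] (hC : IsQuotientingLatticeOfRegular C)
    (hU : LocalStabilizersMem C α) : PolCoverable C α ⊤ := by
  refine (kstar hC hU (biUnion hC Set.finite_univ fun a (_ : a ∈ Set.univ) =>
    singleton hC hU a)).mono fun w _ => ?_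
  refine Language.mem_kstar.2 ⟨w.map fun a => [a], (List.flatMap_singleton' w).symm, ?_⟩
  intro y hy
  obtain ⟨a, _, rfl⟩ := List.mem_map.1 hy
  exact ⟨a, trivial, rfl⟩

end PolCoverable

/-- If all local stabilizers are in `C`, then the languages recognized by `α` are in `Pol(C)`. -/
theorem InPol.of_localStabilizersMem [Finite A] [Finite M] {C : Set (Language A)}
    (hC : IsQuotientingLatticeOfRegular C) {α : WordMorphism A M}
    (hU : LocalStabilizersMem C α) {L : Language A}
    (hL : ∀ u v, α u = α v → u ∈ L → v ∈ L) : InPol C L := by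
  choose Z hZ h₁ h₂ using PolCoverable.top hC hU
  have key : ∀ s : Set M, s.Finite → InPol C {w | ∃ m ∈ s, w ∈ Z m} := by
    intro s hs
    induction s, hs using Set.Finite.induction_on with
    | empty =>
      refine (InPol.base _ hC.bot_mem).of_iff fun w => ?_
      change False ↔ ∃ m ∈ ∅, w ∈ Z m
      simp
    | @insert m s _ _ ih =>
      refine (InPol.union _ _ (hZ m) ih).of_iff fun w => ?_
      change (_ ∨ ∃ m ∈ s, w ∈ Z m) ↔ ∃ m ∈ insert _ s, w ∈ Z m
      simp only [Set.mem_insert_iff, exists_eq_or_imp]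
      rfl
  refine (key {m | ∃ u ∈ L, α u = m} (Set.toFinite _)).of_iff fun w => ?_
  constructor
  · rintro ⟨_, ⟨u, hu, rfl⟩, hw⟩
    exact hL u w (h₂ _ w hw).symm hu
  · exact fun hw => ⟨α w, ⟨w, hw, rfl⟩, h₁ _ w trivial rfl⟩

end PolynomialClosure

/-! ### Insertion into languages of Pol(C), and necessity of the criterion -/

section Necessity

variable {A : Type*}

/-- The power `u ^ n` of a word. -/
def wordPow (u : List A) (n : ℕ) : List A := (List.replicate n u).flatten

theorem wordPow_zero (u : List A) : wordPow u 0 = [] := rfl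

theorem wordPow_succ (u : List A) (n : ℕ) : wordPow u (n + 1) = u ++ wordPow u n := rfl

theorem wordPow_add (u : List A) (m n : ℕ) : wordPow u (m + n) = wordPow u m ++ wordPow u n := by
  rw [wordPow, List.replicate_add, List.flatten_append]; rfl

theorem wordPow_one (u : List A) : wordPow u 1 = u := by simp [wordPow]

theorem wordPow_mul (u : List A) (m n : ℕ) : wordPow u (m * n) = wordPow (wordPow u m) n := by
  induction n with
  | zero => rfl
  | succ n ih => rw [Nat.mul_succ, Nat.add_comm, wordPow_add, ih, wordPow_succ]

/-- Where a marked letter can fall in the word `x uᵃ y`. -/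
theorem append_wordPow_append_eq {u y w₁ w₂ : List A} {l : A} {a : ℕ} {x : List A}
    (h : x ++ wordPow u a ++ y = w₁ ++ l :: w₂) :
    (∃ x', x = w₁ ++ l :: x' ∧ w₂ = x' ++ wordPow u a ++ y) ∨
    (∃ y', y = y' ++ l :: w₂ ∧ w₁ = x ++ wordPow u a ++ y') ∨
    ∃ i j u' u'', i + j + 1 = a ∧ u = u' ++ l :: u'' ∧ w₁ = x ++ wordPow u i ++ u' ∧
      w₂ = u'' ++ wordPow u j ++ y := by
  have split : ∀ p q : List A, p ++ q = w₁ ++ l :: w₂ →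
      (∃ p', p = w₁ ++ l :: p' ∧ w₂ = p' ++ q) ∨ ∃ q', q = q' ++ l :: w₂ ∧ w₁ = p ++ q' := by
    intro p q hpq
    rw [List.append_eq_append_iff] at hpq
    obtain ⟨c, rfl, rfl⟩ | ⟨c, rfl, hc⟩ := hpq
    · exact Or.inr ⟨c, rfl, rfl⟩
    · cases c with
      | nil => exact Or.inr ⟨[], by simpa using hc.symm, by simp⟩
      | cons b c =>
        obtain ⟨rfl, rfl⟩ := List.cons.inj hc
        exact Or.inl ⟨c, rfl, rfl⟩
  induction a generalizing x with
  | zero =>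
    simp only [wordPow_zero, List.append_nil] at h ⊢
    obtain h | h := split _ _ h
    · exact Or.inl h
    · exact Or.inr (Or.inl h)
  | succ a ih =>
    have h' : (x ++ u) ++ wordPow u a ++ y = w₁ ++ l :: w₂ := by
      rw [← h, wordPow_succ]; simp
    obtain ⟨x', hx, rfl⟩ | ⟨y', rfl, rfl⟩ | ⟨i, j, u', u'', rfl, rfl, rfl, rfl⟩ := ih h'
    · rw [List.append_eq_append_iff] at hx
      obtain ⟨c, rfl, hc⟩ | ⟨c, rfl, hc⟩ := hx
      · exact Or.inr (Or.inr ⟨0, a, c, x', by omega, hc, by simp [wordPow_zero], rfl⟩)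
      · cases c with
        | nil =>
          exact Or.inr (Or.inr ⟨0, a, [], x', by omega, by simpa using hc.symm,
            by simp [wordPow_zero], rfl⟩)
        | cons b c =>
          obtain ⟨rfl, rfl⟩ := List.cons.inj hc
          exact Or.inl ⟨c, rfl, by simp [wordPow_succ]⟩
    · exact Or.inr (Or.inl ⟨y', rfl, by simp [wordPow_succ]⟩)
    · exact Or.inr (Or.inr ⟨i + 1, j, u', u'', by omega, rfl, by simp [wordPow_succ], rfl⟩)

/-- Every occurrence of `u` in a word of a language of `D` can be replaced by `v`. -/
def ContextLE (D : Set (Language A)) (u v : List A) : Prop :=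
  ∀ K ∈ D, ∀ x y : List A, x ++ u ++ y ∈ K → x ++ v ++ y ∈ K

namespace ContextLE

variable {D E : Set (Language A)} {u v w u' v' : List A}

theorem refl (u : List A) : ContextLE D u u := fun _ _ _ _ h => h

theorem trans (h : ContextLE D u v) (h' : ContextLE D v w) : ContextLE D u w :=
  fun K hK x y hu => h' K hK x y (h K hK x y hu)

theorem mono (hD : E ⊆ D) (h : ContextLE D u v) : ContextLE E u v := fun K hK => h K (hD hK)

theorem append (h : ContextLE D u v) (h' : ContextLE D u' v') :
    ContextLE D (u ++ u') (v ++ v') := by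
  intro K hK x y hu
  have h₁ := h K hK x (u' ++ y) (by simpa using hu)
  have h₂ := h' K hK (x ++ v) y (by simpa using h₁)
  simpa using h₂

theorem wordPow_le (h : ContextLE D (u ++ u) u) :
    ∀ {n : ℕ}, 1 ≤ n → ContextLE D (wordPow u n) u := by
  intro n hn
  induction n, hn using Nat.le_induction with
  | base => rw [wordPow_one]; exact refl u
  | succ n _ ih => rw [wordPow_succ]; exact ((refl u).append ih).trans h

end ContextLE

/-- The words `w` with `x w y ∈ L`. -/
def contextQuotient (L : Language A) (x y : List A) : Language A := {w | x ++ w ++ y ∈ L}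

/-- All two-sided quotients of the languages of `D`. -/
def contextQuotients (D : Set (Language A)) : Set (Language A) :=
  {Q | ∃ K ∈ D, ∃ x y, Q = contextQuotient K x y}

theorem contextLE_iff {D : Set (Language A)} {u v : List A} :
    ContextLE D u v ↔ ∀ Q ∈ contextQuotients D, u ∈ Q → v ∈ Q := by
  constructor
  · rintro h _ ⟨K, hK, x, y, rfl⟩ hu
    exact h K hK x y hu
  · intro h K hK x y hu
    exact h _ ⟨K, hK, x, y, rfl⟩ hu

/-- In a DFA, the quotient by x and y depends only on the state reached by x and the set of states
from which y is accepted. -/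
theorem Language.IsRegular.finite_contextQuotients {L : Language A} (hL : L.IsRegular) :
    (contextQuotients {L}).Finite := by
  obtain ⟨σ, _, M, rfl⟩ := hL
  refine (Set.finite_range fun p : σ × Set σ => ({w | M.evalFrom p.1 w ∈ p.2} : Language A)).subset
    ?_
  rintro _ ⟨_, rfl, x, y, rfl⟩
  refine ⟨(M.eval x, {s | M.evalFrom s y ∈ M.accept}), ?_⟩
  ext w
  change M.evalFrom (M.evalFrom (M.evalFrom M.start x) w) y ∈ M.accept ↔
    M.evalFrom M.start (x ++ w ++ y) ∈ M.accept
  simp only [DFA.evalFrom_of_append]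

theorem finite_contextQuotients {D : Set (Language A)} (hD : D.Finite)
    (hreg : ∀ L ∈ D, L.IsRegular) : (contextQuotients D).Finite := by
  refine (hD.biUnion fun L hL => (hreg L hL).finite_contextQuotients).subset ?_
  rintro Q ⟨K, hK, x, y, rfl⟩
  exact Set.mem_biUnion hK ⟨K, rfl, x, y, rfl⟩

/-- Some power of each word is idempotent up to `ContextLE D`. -/
theorem exists_wordPow_idempotent {D : Set (Language A)} (hD : (contextQuotients D).Finite)
    (z : List A) : ∃ n, 1 ≤ n ∧ ContextLE D (wordPow z n ++ wordPow z n) (wordPow z n) ∧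
      ContextLE D (wordPow z n) (wordPow z n ++ wordPow z n) := by
  have hfin : (Set.range fun n : ℕ => {Q ∈ contextQuotients D | wordPow z n ∈ Q}).Finite :=
    hD.finite_subsets.subset (by rintro _ ⟨n, rfl⟩ Q hQ; exact hQ.1)
  -- Pigeonhole: two powers lie in the same quotients, so powers are periodic from exponent i on,
  -- with period j - i = p + 1.
  obtain ⟨i, j, hij, h⟩ : ∃ i j : ℕ, i < j ∧ {Q ∈ contextQuotients D | wordPow z i ∈ Q} =
      {Q ∈ contextQuotients D | wordPow z j ∈ Q} := by
    by_contra! hne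
    refine Set.infinite_range_of_injective (fun i j hij => ?_) hfin
    rcases lt_trichotomy i j with h | h | h
    · exact (hne i j h hij).elim
    · exact h
    · exact (hne j i h hij.symm).elim
  obtain ⟨p, rfl⟩ := Nat.exists_eq_add_of_lt hij
  have h₁ : ContextLE D (wordPow z i) (wordPow z (i + p + 1)) := contextLE_iff.2 fun Q hQ hu =>
    ((Set.ext_iff.1 h Q).1 ⟨hQ, hu⟩).2
  have h₂ : ContextLE D (wordPow z (i + p + 1)) (wordPow z i) := contextLE_iff.2 fun Q hQ hu =>
    ((Set.ext_iff.1 h Q).2 ⟨hQ, hu⟩).2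
  have key : ∀ k m, ContextLE D (wordPow z (i + m)) (wordPow z (i + m + k * (p + 1))) ∧
      ContextLE D (wordPow z (i + m + k * (p + 1))) (wordPow z (i + m)) := by
    intro k
    induction k with
    | zero => intro m; simpa using ContextLE.refl _
    | succ k ih =>
      intro m
      have e : i + m + (k + 1) * (p + 1) = i + p + 1 + (m + k * (p + 1)) := by ring
      have e' : i + m + k * (p + 1) = i + (m + k * (p + 1)) := by ring
      have := ih m
      rw [e', wordPow_add z i (m + _)] at this
      rw [e, wordPow_add z (i + p + 1)]
      exact ⟨this.1.trans (h₁.append (.refl _)), (h₂.append (.refl _)).trans this.2⟩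
  -- A positive multiple of the period that is at least i: doubling it stays in the same class.
  refine ⟨(i + 1) * (p + 1), Nat.mul_pos (by omega) (by omega), ?_⟩
  obtain ⟨m, hm⟩ : ∃ m, (i + 1) * (p + 1) = i + m :=
    Nat.exists_eq_add_of_le (by nlinarith)
  have := key (i + 1) m
  rw [← hm, wordPow_add] at this
  exact ⟨this.2, this.1⟩

theorem Language.mem_of_iff {C : Set (Language A)} {K L : Language A} (hK : K ∈ C)
    (h : ∀ w, w ∈ K ↔ w ∈ L) : L ∈ C :=
  (Language.ext h : K = L) ▸ hK

/-- A language that is closed upwards for `ContextLE D`, where `D` is a finite part of `C`,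
belongs to `C`. -/
theorem mem_of_contextLE_closed {C : Set (Language A)} (hC : IsQuotientingLatticeOfRegular C)
    {D : Set (Language A)} (hD : D.Finite) (hDC : D ⊆ C) {U : Language A}
    (hU : ∀ u v, ContextLE D u v → u ∈ U → v ∈ U) : U ∈ C := by
  have hfin := finite_contextQuotients hD fun L hL => hC.regular L (hDC hL)
  have hmem : contextQuotients D ⊆ C := by
    rintro _ ⟨K, hK, x, y, rfl⟩
    have := hC.rightQuotient_mem _ (hC.leftQuotient_mem K (hDC hK) x) y
    refine Language.mem_of_iff this fun w => ?_
    change x ++ (w ++ y) ∈ K ↔ x ++ w ++ y ∈ K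
    rw [List.append_assoc]
  have hinter : ∀ s : Set (Language A), s.Finite → s ⊆ C →
      ({w | ∀ Q ∈ s, w ∈ Q} : Language A) ∈ C := by
    intro s hs
    induction s, hs using Set.Finite.induction_on with
    | empty =>
      intro _
      refine Language.mem_of_iff hC.top_mem fun w => ?_
      symm
      change (∀ Q ∈ ∅, w ∈ Q) ↔ True
      simp
    | @insert Q s _ _ ih =>
      intro hs
      refine Language.mem_of_iff (hC.inter_mem _ (hs (Set.mem_insert ..)) _
        (ih ((Set.subset_insert ..).trans hs))) fun w => ?_
      symm
      change (∀ R ∈ insert Q s, w ∈ R) ↔ w ∈ Q ∧ ∀ R ∈ s, w ∈ R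
      simp
  have hunion : ∀ s : Set (Set (Language A)), s.Finite → s ⊆ 𝒫 (contextQuotients D) →
      ({w | ∃ T ∈ s, ∀ Q ∈ T, w ∈ Q} : Language A) ∈ C := by
    intro s hs
    induction s, hs using Set.Finite.induction_on with
    | empty =>
      intro _
      refine Language.mem_of_iff hC.bot_mem fun w => ?_
      symm
      change (∃ T ∈ ∅, ∀ Q ∈ T, w ∈ Q) ↔ False
      simp
    | @insert T s _ _ ih =>
      intro hs
      have hT := hs (Set.mem_insert ..)
      refine Language.mem_of_iff (hC.union_mem _ (hinter T (hfin.subset hT) (hT.trans hmem)) _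
        (ih ((Set.subset_insert ..).trans hs))) fun w => ?_
      symm
      change (∃ R ∈ insert T s, ∀ Q ∈ R, w ∈ Q) ↔ (∀ Q ∈ T, w ∈ Q) ∨ ∃ R ∈ s, ∀ Q ∈ R, w ∈ Q
      simp
  -- U is the union over u in U of the intersection of all quotients containing u; only finitely
  -- many such sets of quotients exist.
  refine Language.mem_of_iff (hunion {T | ∃ u ∈ U, T = {Q ∈ contextQuotients D | u ∈ Q}}
    (hfin.finite_subsets.subset (by rintro _ ⟨u, _, rfl⟩ Q hQ; exact hQ.1))
    (by rintro _ ⟨u, _, rfl⟩ Q hQ; exact hQ.1)) fun w => ?_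
  symm
  constructor
  · exact fun hw => ⟨_, ⟨w, hw, rfl⟩, fun Q hQ => hQ.2⟩
  · rintro ⟨_, ⟨u, hu, rfl⟩, h⟩
    exact hU u w (contextLE_iff.2 fun Q hQ huQ => h Q ⟨hQ, huQ⟩) hu

/-- A language of `Pol(C)` is closed under inserting a larger word into a long power of an
idempotent word. -/
theorem InPol.exists_insertion {C : Set (Language A)} {L : Language A} (hL : InPol C L) :
    ∃ D : Set (Language A), D.Finite ∧ D ⊆ C ∧ ∃ a₀ : ℕ, ∀ a ≥ a₀, ∀ u v : List A,
      ContextLE D (u ++ u) u → ContextLE D u (u ++ u) → ContextLE D u v → ∀ x y,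
      x ++ wordPow u a ++ y ∈ L → ∃ b c : ℕ, 1 ≤ b ∧ 1 ≤ c ∧
        x ++ wordPow u b ++ v ++ wordPow u c ++ y ∈ L := by
  induction hL with
  | base L hL =>
    refine ⟨{L}, Set.finite_singleton L, by simpa using hL, 1, ?_⟩
    intro a ha u v h₁ h₂ huv x y h
    refine ⟨1, 1, le_rfl, le_rfl, ?_⟩
    -- In the preorder, uᵃ ≤ u ≤ u u ≤ u u u ≤ u v u, where the middle factor is raised from u to v.
    have h₃ : ContextLE {L} (wordPow u a) (u ++ v ++ u) :=
      (h₁.wordPow_le ha).trans (h₂.trans ((h₂.trans ((ContextLE.refl u).append huv)).append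
        (.refl u)))
    have := h₃ L rfl x y h
    simpa [wordPow_one] using this
  | union K L _ _ ihK ihL =>
    obtain ⟨D, hD, hDC, a₁, h₁⟩ := ihK
    obtain ⟨E, hE, hEC, a₂, h₂⟩ := ihL
    refine ⟨D ∪ E, hD.union hE, Set.union_subset hDC hEC, a₁ + a₂, ?_⟩
    intro a ha u v hu hu' huv x y h
    have hDm : D ⊆ D ∪ E := Set.subset_union_left
    have hEm : E ⊆ D ∪ E := Set.subset_union_right
    obtain h | h := h
    · obtain ⟨b, c, hb, hc, h⟩ := h₁ a (by omega) u v (hu.mono hDm) (hu'.mono hDm)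
        (huv.mono hDm) x y h
      exact ⟨b, c, hb, hc, Or.inl h⟩
    · obtain ⟨b, c, hb, hc, h⟩ := h₂ a (by omega) u v (hu.mono hEm) (hu'.mono hEm)
        (huv.mono hEm) x y h
      exact ⟨b, c, hb, hc, Or.inr h⟩
  | markedConcat K L l _ _ ihK ihL =>
    obtain ⟨D, hD, hDC, a₁, h₁⟩ := ihK
    obtain ⟨E, hE, hEC, a₂, h₂⟩ := ihL
    refine ⟨D ∪ E, hD.union hE, Set.union_subset hDC hEC, a₁ + a₂ + 1, ?_⟩
    intro a ha u v hu hu' huv x y h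
    have hDm : D ⊆ D ∪ E := Set.subset_union_left
    have hEm : E ⊆ D ∪ E := Set.subset_union_right
    have hK := fun a ha => h₁ a ha u v (hu.mono hDm) (hu'.mono hDm) (huv.mono hDm)
    have hL := fun a ha => h₂ a ha u v (hu.mono hEm) (hu'.mono hEm) (huv.mono hEm)
    obtain ⟨_, ⟨w₁, hw₁, _, rfl, rfl⟩, w₂, hw₂, hw⟩ := h
    have mem : ∀ w, (∃ s ∈ K, ∃ t ∈ L, w = s ++ l :: t) → w ∈ K * ({[l]} : Language A) * L := by
      rintro _ ⟨s, hs, t, ht, rfl⟩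
      exact ⟨s ++ [l], ⟨s, hs, [l], rfl, rfl⟩, t, ht, by simp⟩
    obtain ⟨x', rfl, rfl⟩ | ⟨y', rfl, rfl⟩ | ⟨i, j, u', u'', hij, hu'', rfl, rfl⟩ :=
      append_wordPow_append_eq (w₁ := w₁) (l := l) (w₂ := w₂) (by simpa using hw.symm)
    · obtain ⟨b, c, hb, hc, h⟩ := hL a (by omega) x' y hw₂
      exact ⟨b, c, hb, hc, mem _ ⟨w₁, hw₁, _, h, by simp⟩⟩
    · obtain ⟨b, c, hb, hc, h⟩ := hK a (by omega) x y' hw₁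
      exact ⟨b, c, hb, hc, mem _ ⟨_, h, w₂, hw₂, by simp⟩⟩
    -- The marked letter falls inside one copy of u, leaving i + j = a - 1 ≥ a₁ + a₂ copies, so one
    -- side is long enough for its induction hypothesis. The broken copy is then reassembled.
    · obtain hi | hj : a₁ ≤ i ∨ a₂ ≤ j := by omega
      · obtain ⟨b, c, hb, hc, h⟩ := hK i hi x u' hw₁
        refine ⟨b, c + (1 + j), hb, by omega, mem _ ⟨_, h, _, hw₂, ?_⟩⟩
        rw [wordPow_add u c, wordPow_add u 1, wordPow_one]
        nth_rw 3 [hu'']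
        simp
      · obtain ⟨b, c, hb, hc, h⟩ := hL j hj u'' y hw₂
        refine ⟨i + (1 + b), c, by omega, hc, mem _ ⟨_, hw₁, _, h, ?_⟩⟩
        rw [wordPow_add u i, wordPow_add u 1, wordPow_one]
        nth_rw 2 [hu'']
        simp

/-- The syntactic congruence of `L`. -/
def SynEq (L : Language A) (u v : List A) : Prop :=
  ∀ x y : List A, x ++ u ++ y ∈ L ↔ x ++ v ++ y ∈ L

namespace SynEq

variable {L : Language A} {u v w u' v' : List A}

theorem refl (u : List A) : SynEq L u u := fun _ _ => Iff.rfl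

theorem symm (h : SynEq L u v) : SynEq L v u := fun x y => (h x y).symm

theorem trans (h : SynEq L u v) (h' : SynEq L v w) : SynEq L u w :=
  fun x y => (h x y).trans (h' x y)

theorem append (h : SynEq L u v) (h' : SynEq L u' v') : SynEq L (u ++ u') (v ++ v') := by
  intro x y
  have h₁ := h x (u' ++ y)
  have h₂ := h' (x ++ v) y
  simp only [List.append_assoc] at h₁ h₂ ⊢
  exact h₁.trans h₂

theorem mem_iff (h : SynEq L u v) : u ∈ L ↔ v ∈ L := by simpa using h [] []

theorem compl (h : SynEq L u v) : SynEq Lᶜ u v := fun x y => not_congr (h x y)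

theorem wordPow_of_idempotent (h : SynEq L (u ++ u) u) {n : ℕ} (hn : 1 ≤ n) :
    SynEq L (wordPow u n) u := by
  induction n, hn using Nat.le_induction with
  | base => rw [wordPow_one]; exact refl u
  | succ n _ ih => rw [wordPow_succ]; exact ((refl u).append ih).trans h

theorem wordPow (h : SynEq L u v) (n : ℕ) : SynEq L (wordPow u n) (_root_.wordPow v n) := by
  induction n with
  | zero => exact refl _
  | succ n ih => exact h.append ih

end SynEq

/-- One half of the closure of local stabilizers under `ContextLE D`. -/
theorem InPol.exists_forall_insertion {C : Set (Language A)}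
    (hC : IsQuotientingLatticeOfRegular C) {L : Language A} (hL : InPol C L) :
    ∃ D : Set (Language A), D.Finite ∧ D ⊆ C ∧ ∀ e w w' : List A, SynEq L (e ++ e) e →
      SynEq L (e ++ w ++ e) e → ContextLE D w w' → ∀ x y, x ++ e ++ y ∈ L →
      x ++ (e ++ w' ++ e) ++ y ∈ L := by
  obtain ⟨D, hD, hDC, a₀, h⟩ := hL.exists_insertion
  refine ⟨D, hD, hDC, ?_⟩
  intro e w w' he hw hww x y hxy
  -- Let z = e w e and n = m + 1. The insertion property is applied to u = zⁿ and v = zᵐ(e w' e):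
  -- then u ≤ v, powers of u are syntactically e, and e v e is syntactically e w' e.
  obtain ⟨n, hn, h₁, h₂⟩ := exists_wordPow_idempotent
    (finite_contextQuotients hD fun L hL => hC.regular L (hDC hL)) (e ++ w ++ e)
  have hz : ∀ k, 1 ≤ k → SynEq L (wordPow (wordPow (e ++ w ++ e) n) k) e := by
    intro k hk
    rw [← wordPow_mul]
    exact (hw.wordPow _).trans (he.wordPow_of_idempotent (Nat.mul_pos hn hk))
  obtain ⟨m, rfl⟩ := Nat.exists_eq_add_of_le' hn
  have hzm : SynEq L (e ++ (wordPow (e ++ w ++ e) m ++ (e ++ w' ++ e)) ++ e) (e ++ w' ++ e) := by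
    obtain rfl | hm := Nat.eq_zero_or_pos m
    · have := (he.append (.refl w')).append he
      simpa [wordPow_zero] using this
    · have h₃ := (hw.wordPow m).trans (he.wordPow_of_idempotent hm)
      have h₄ := (((((SynEq.refl e).append h₃).append (.refl e)).trans
        ((he.append (.refl e)).trans he)).append (.refl w')).append he
      simpa using h₄
  obtain ⟨b, c, hb, hc, hbc⟩ := h (a₀ + 1) (by omega) (wordPow (e ++ w ++ e) (m + 1))
    (wordPow (e ++ w ++ e) m ++ (e ++ w' ++ e)) h₁ h₂
    (by
      rw [wordPow_add, wordPow_one]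
      exact (ContextLE.refl _).append (((ContextLE.refl e).append hww).append (.refl e))) x y
    ((hz (a₀ + 1) (by omega) x y).2 hxy)
  have := (((hz b hb).append (.refl _)).append (hz c hc)).trans hzm
  exact (this x y).1 (by simpa using hbc)

/-- The local stabilizers of a language of `Pol(C) ∩ co-Pol(C)` belong to `C`. -/
theorem localStabilizer_mem {C : Set (Language A)} (hC : IsQuotientingLatticeOfRegular C)
    {L : Language A} (hL : L ∈ Pol C ∩ coPol C) {e : List A} (he : SynEq L (e ++ e) e) :
    ({w | SynEq L (e ++ w ++ e) e} : Language A) ∈ C := by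
  obtain ⟨D, hD, hDC, h₁⟩ := InPol.exists_forall_insertion hC hL.1
  obtain ⟨E, hE, hEC, h₂⟩ := InPol.exists_forall_insertion hC hL.2
  refine mem_of_contextLE_closed hC (hD.union hE) (Set.union_subset hDC hEC) ?_
  intro u v huv hu x y
  have hu : SynEq L (e ++ u ++ e) e := hu
  -- The implication from right to left comes from insertion into L; the other is the contrapositive
  -- of insertion into the complement.
  constructor
  · intro h
    by_contra hxy
    exact h₂ e u v he.compl hu.compl (huv.mono Set.subset_union_right) x y hxy h
  · exact h₁ e u v he hu (huv.mono Set.subset_union_left) x y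

end Necessity

/-! ### The syntactic monoid and the algebraic criterion -/

section Criterion

variable {A : Type*}

/-- The syntactic congruence of `L`, as a setoid. -/
def synSetoid (L : Language A) : Setoid (List A) where
  r := SynEq L
  iseqv := ⟨SynEq.refl, SynEq.symm, SynEq.trans⟩

/-- The syntactic monoid of `L`. -/
def SyntacticMonoid (L : Language A) : Type _ := Quotient (synSetoid L)

instance (L : Language A) : Monoid (SyntacticMonoid L) where
  mul := Quotient.map₂ (· ++ ·) fun _ _ h _ _ h' => SynEq.append h h'
  one := Quotient.mk _ []
  mul_assoc := by
    rintro ⟨u⟩ ⟨v⟩ ⟨w⟩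
    exact congrArg (Quotient.mk (synSetoid L)) (List.append_assoc u v w)
  one_mul := by
    rintro ⟨u⟩
    exact congrArg (Quotient.mk (synSetoid L)) (List.nil_append u)
  mul_one := by
    rintro ⟨u⟩
    exact congrArg (Quotient.mk (synSetoid L)) (List.append_nil u)

/-- The syntactic morphism of `L`. -/
def syntacticMorphism (L : Language A) : WordMorphism A (SyntacticMonoid L) where
  toFun := Quotient.mk (synSetoid L)
  map_nil := rfl
  map_append _ _ := rfl

theorem syntacticMorphism_eq_iff {L : Language A} {u v : List A} :
    syntacticMorphism L u = syntacticMorphism L v ↔ SynEq L u v :=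
  Quotient.eq (r := synSetoid L)

/-- A syntactic class is determined by which of the finitely many two-sided quotients of L contain
it. -/
theorem Language.IsRegular.finite_syntacticMonoid {L : Language A} (hL : L.IsRegular) :
    Finite (SyntacticMonoid L) := by
  have := hL.finite_contextQuotients.finite_subsets.to_subtype
  let f : SyntacticMonoid L → {T : Set (Language A) | T ⊆ contextQuotients {L}} :=
    Quotient.lift (fun u => ⟨{Q ∈ contextQuotients {L} | u ∈ Q}, fun Q hQ => hQ.1⟩) (by
      intro u v (h : SynEq L u v)
      ext Q
      refine and_congr_right ?_
      rintro ⟨_, rfl, x, y, rfl⟩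
      exact h x y)
  refine Finite.of_injective f ?_
  rintro ⟨u⟩ ⟨v⟩ h
  refine Quotient.sound (s := synSetoid L) fun x y => ?_
  have hQ : contextQuotient L x y ∈ contextQuotients {L} := ⟨L, rfl, x, y, rfl⟩
  have := Set.ext_iff.1 (congrArg Subtype.val h) (contextQuotient L x y)
  exact (and_congr_right_iff.1 this) hQ

/-- A regular language is in `Pol(C) ∩ co-Pol(C)` if and only if all of its local stabilizers
are in `C`. -/
theorem mem_Pol_inter_coPol_iff [Finite A] {C : Set (Language A)}
    (hC : IsQuotientingLatticeOfRegular C) {L : Language A} (hL : L.IsRegular) :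
    L ∈ Pol C ∩ coPol C ↔ ∀ e : List A, SynEq L (e ++ e) e →
      ({w | SynEq L (e ++ w ++ e) e} : Language A) ∈ C := by
  refine ⟨fun h e he => localStabilizer_mem hC h he, fun h => ?_⟩
  have := hL.finite_syntacticMonoid
  have hU : LocalStabilizersMem C (syntacticMorphism L) := by
    rintro ⟨e⟩ he
    exact Language.mem_of_iff (h e (syntacticMorphism_eq_iff.1 he)) fun w =>
      (syntacticMorphism_eq_iff (u := e ++ w ++ e)).symm
  exact ⟨.of_localStabilizersMem hC hU fun u v huv =>
      (syntacticMorphism_eq_iff.1 huv).mem_iff.1,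
    .of_localStabilizersMem hC hU fun u v huv =>
      (syntacticMorphism_eq_iff.1 huv).compl.mem_iff.1⟩

end Criterion

/-! ### Representatives of syntactic classes and automata for the stabilizers -/

section Codes

variable {A : Type*}

/-- One step of the subset construction, on lists. -/
noncomputable def NFACode.stepList (c : NFACode A) (S : List ℕ) (a : A) : List ℕ :=
  open Classical in (c.2.1.filter fun t => t.1 ∈ S ∧ t.2.1 = a).map fun t => t.2.2

theorem NFACode.mem_foldl_stepList (c : NFACode A) (w : List A) (S : List ℕ) (q : ℕ) :
    q ∈ w.foldl c.stepList S ↔ q ∈ c.toNFA.evalFrom {p | p ∈ S} w := by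
  induction w generalizing S with
  | nil => rfl
  | cons a w ih =>
    rw [List.foldl_cons, ih, NFA.evalFrom_cons]
    suffices {p | p ∈ c.stepList S a} = c.toNFA.stepSet {p | p ∈ S} a by rw [this]
    ext q
    rw [NFA.mem_stepSet]
    change q ∈ c.stepList S a ↔ ∃ p ∈ S, (p, a, q) ∈ c.2.1
    simp only [NFACode.stepList, List.mem_map, List.mem_filter, decide_eq_true_eq, Prod.exists]
    constructor
    · rintro ⟨p, b, q, ⟨h, hp, rfl⟩, rfl⟩
      exact ⟨p, hp, h⟩
    · rintro ⟨p, hp, h⟩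
      exact ⟨p, a, q, ⟨h, hp, rfl⟩, rfl⟩

theorem NFACode.mem_language_iff (c : NFACode A) (w : List A) :
    w ∈ c.language ↔ ∃ q ∈ c.2.2, q ∈ w.foldl c.stepList c.1 := by
  simp only [NFACode.mem_foldl_stepList]
  exact NFA.mem_accepts

/-- The syntactic class of a word is determined by the transitions between states. -/
theorem NFACode.synEq_of_evalFrom_eq (c : NFACode A) {u v : List A}
    (h : ∀ p q, q ∈ c.toNFA.evalFrom {p} u ↔ q ∈ c.toNFA.evalFrom {p} v) :
    SynEq c.language u v := by
  have h' : ∀ S, c.toNFA.evalFrom S u = c.toNFA.evalFrom S v := by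
    intro S
    ext q
    rw [NFA.mem_evalFrom_iff_exists, NFA.mem_evalFrom_iff_exists]
    simp only [h]
  intro x y
  simp only [NFACode.language, NFA.mem_accepts, NFA.evalFrom_append, h']

/-- A bound for the length of the words that represent all syntactic classes. -/
def NFACode.bound (c : NFACode A) : ℕ := 2 ^ (c.2.1.length * c.2.1.length)

/-- In a word longer than the bound, two prefixes induce the same relation on states; replacing the
longer by the shorter keeps the syntactic class and shortens the word. -/
theorem NFACode.exists_short (c : NFACode A) (w : List A) :
    ∃ v : List A, v.length ≤ c.bound ∧ SynEq c.language w v := by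
  classical
  induction hn : w.length using Nat.strong_induction_on generalizing w with | _ n ih
  by_cases hw : w.length ≤ c.bound
  · exact ⟨w, hw, .refl w⟩
  let P : Finset (ℕ × ℕ) :=
    (c.2.1.map fun t => t.1).toFinset ×ˢ (c.2.1.map fun t => t.2.2).toFinset
  have hP : P.card ≤ c.2.1.length * c.2.1.length := by
    rw [Finset.card_product]
    exact Nat.mul_le_mul ((List.toFinset_card_le _).trans (by simp))
      ((List.toFinset_card_le _).trans (by simp))
  -- Prefixes have length i + 1 because the empty word relates every natural number to itself,
  -- whereas a nonempty word only relates endpoints of listed transitions, so pairs of P.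
  let f : ℕ → Finset (ℕ × ℕ) := fun i =>
    P.filter fun p => p.2 ∈ c.toNFA.evalFrom {p.1} (w.take (i + 1))
  obtain ⟨i, hi, j, hj, hij, hf⟩ := Finset.exists_ne_map_eq_of_card_lt_of_maps_to
    (s := Finset.range (c.bound + 1)) (t := P.powerset) (f := f) (by
      rw [Finset.card_powerset, Finset.card_range, Nat.lt_succ_iff]
      exact Nat.pow_le_pow_right (by norm_num) hP)
    (fun i _ => Finset.mem_powerset.2 (Finset.filter_subset ..))
  wlog hlt : i < j generalizing i j
  · exact this j hj i hi hij.symm hf.symm (by omega)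
  rw [Finset.mem_range] at hi hj
  have hmem : ∀ v : List A, v ≠ [] → ∀ p q, q ∈ c.toNFA.evalFrom {p} v → (p, q) ∈ P := by
    intro v hv p q hq
    refine Finset.mem_product.2 ⟨?_, ?_⟩
    · obtain ⟨a, v, rfl⟩ := List.exists_cons_of_ne_nil hv
      rw [NFA.evalFrom_cons, NFA.mem_evalFrom_iff_exists] at hq
      obtain ⟨r, hr, -⟩ := hq
      rw [NFA.mem_stepSet] at hr
      obtain ⟨_, rfl, hr⟩ := hr
      exact List.mem_toFinset.2 (List.mem_map.2 ⟨_, hr, rfl⟩)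
    · obtain ⟨v, a, rfl⟩ := (List.eq_nil_or_concat' v).resolve_left hv
      rw [NFA.evalFrom_append, NFA.evalFrom_singleton, NFA.mem_stepSet] at hq
      obtain ⟨r, -, hr⟩ := hq
      exact List.mem_toFinset.2 (List.mem_map.2 ⟨_, hr, rfl⟩)
  have hne : ∀ k, w.take (k + 1) ≠ [] := by
    intro k h
    have := congrArg List.length h
    rw [List.length_take] at this
    simp only [List.length_nil] at this
    omega
  have hsyn : SynEq c.language (w.take (i + 1)) (w.take (j + 1)) := by
    refine c.synEq_of_evalFrom_eq fun p q => ?_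
    have := Finset.ext_iff.1 hf (p, q)
    simp only [f, Finset.mem_filter] at this
    exact ⟨fun h => (this.1 ⟨hmem _ (hne i) p q h, h⟩).2,
      fun h => (this.2 ⟨hmem _ (hne j) p q h, h⟩).2⟩
  have hw' : SynEq c.language w (w.take (i + 1) ++ w.drop (j + 1)) := by
    have := hsyn.symm.append (.refl (w.drop (j + 1)))
    rwa [List.take_append_drop] at this
  obtain ⟨v, hv, hwv⟩ := ih _ (by
    rw [← hn, List.length_append, List.length_take, List.length_drop]
    omega) (w.take (i + 1) ++ w.drop (j + 1)) rfl
  exact ⟨v, hv, hw'.trans hwv⟩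

variable [Finite A]

variable (A) in
/-- The letters of a finite alphabet, as a list. -/
noncomputable def alphabetList : List A := (Set.finite_univ (α := A)).toFinset.toList

theorem mem_alphabetList (a : A) : a ∈ alphabetList A := by simp [alphabetList]

variable (A) in
/-- The words of length at most `n`, as a list. -/
noncomputable def wordsUpTo : ℕ → List (List A)
  | 0 => [[]]
  | n + 1 => [] :: (wordsUpTo n).flatMap fun w => (alphabetList A).map fun a => a :: w

theorem mem_wordsUpTo {n : ℕ} {w : List A} : w ∈ wordsUpTo A n ↔ w.length ≤ n := by
  induction n generalizing w with
  | zero => simp [wordsUpTo]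
  | succ n ih =>
    cases w with
    | nil => simp [wordsUpTo]
    | cons a w => simp [wordsUpTo, ih, mem_alphabetList]

namespace NFACode

/-- Words that represent all syntactic classes of the language of `c`. -/
noncomputable def representatives (c : NFACode A) : List (List A) := wordsUpTo A c.bound

theorem exists_mem_representatives (c : NFACode A) (w : List A) :
    ∃ v ∈ c.representatives, SynEq c.language w v := by
  obtain ⟨v, hv, h⟩ := c.exists_short w
  exact ⟨v, mem_wordsUpTo.2 hv, h⟩

/-- The contexts made of representatives decide the syntactic congruence. -/
theorem synEq_iff (c : NFACode A) (u v : List A) : SynEq c.language u v ↔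
    ∀ x ∈ c.representatives, ∀ y ∈ c.representatives,
      (x ++ u ++ y ∈ c.language ↔ x ++ v ++ y ∈ c.language) := by
  refine ⟨fun h x _ y _ => h x y, fun h x y => ?_⟩
  obtain ⟨x', hx', hx⟩ := c.exists_mem_representatives x
  obtain ⟨y', hy', hy⟩ := c.exists_mem_representatives y
  exact (((hx.append (.refl u)).append hy).mem_iff.trans (h x' hx' y' hy')).trans
    ((hx.append (.refl v)).append hy).mem_iff.symm

variable [Primcodable A]

/-- An automaton for the words `w` such that `e w e` is syntactically equivalent to `e`. Its
states are codes of representatives. -/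
noncomputable def stabilizer (c : NFACode A) (e : List A) : NFACode A :=
  open Classical in
  ([Encodable.encode ([] : List A)],
    (c.representatives.flatMap fun u => (alphabetList A).flatMap fun a =>
      (c.representatives.filter fun v => SynEq c.language (u ++ [a]) v).map fun v =>
        (Encodable.encode u, a, Encodable.encode v)),
    (c.representatives.filter fun v => SynEq c.language (e ++ v ++ e) e).map Encodable.encode)

theorem mem_stabilizer_transitions (c : NFACode A) (e : List A) {p q : ℕ} {a : A} :
    (p, a, q) ∈ (c.stabilizer e).2.1 ↔ ∃ u ∈ c.representatives, ∃ v ∈ c.representatives,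
      SynEq c.language (u ++ [a]) v ∧ p = Encodable.encode u ∧ q = Encodable.encode v := by
  simp only [stabilizer, List.mem_flatMap, List.mem_map, List.mem_filter, decide_eq_true_eq,
    Prod.mk.injEq]
  constructor
  · rintro ⟨u, hu, b, -, v, ⟨hv, h⟩, rfl, rfl, rfl⟩
    exact ⟨u, hu, v, hv, h, rfl, rfl⟩
  · rintro ⟨u, hu, v, hv, h, rfl, rfl⟩
    exact ⟨u, hu, a, mem_alphabetList a, v, ⟨hv, h⟩, rfl, rfl, rfl⟩

/-- No canonical representative is chosen: after reading w, every reached state encodes a word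
equivalent to w, and at least one state is reached. Acceptance depends only on the class, so
nondeterminism is harmless. -/
theorem language_stabilizer (c : NFACode A) (e : List A) :
    (c.stabilizer e).language = {w | SynEq c.language (e ++ w ++ e) e} := by
  have hsound : ∀ w q, q ∈ (c.stabilizer e).toNFA.evalFrom (c.stabilizer e).toNFA.start w →
      ∃ v ∈ c.representatives, q = Encodable.encode v ∧ SynEq c.language w v := by
    intro w
    induction w using List.reverseRecOn with
    | nil =>
      intro q hq
      obtain rfl : q = _ := List.mem_singleton.1 hq
      exact ⟨[], mem_wordsUpTo.2 (Nat.zero_le _), rfl, .refl _⟩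
    | append_singleton w a ih =>
      intro q hq
      rw [NFA.evalFrom_append, NFA.evalFrom_singleton, NFA.mem_stepSet] at hq
      obtain ⟨p, hp, hpq⟩ := hq
      obtain ⟨u, -, v, hv, huv, rfl, rfl⟩ := (c.mem_stabilizer_transitions e).1 hpq
      obtain ⟨u', -, huu', hwu⟩ := ih _ hp
      obtain rfl := Encodable.encode_injective huu'
      exact ⟨v, hv, rfl, (hwu.append (.refl [a])).trans huv⟩
  have hne : ∀ w, ∃ q, q ∈ (c.stabilizer e).toNFA.evalFrom (c.stabilizer e).toNFA.start w := by
    intro w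
    induction w using List.reverseRecOn with
    | nil => exact ⟨_, List.mem_singleton.2 rfl⟩
    | append_singleton w a ih =>
      obtain ⟨p, hp⟩ := ih
      obtain ⟨u, hu, rfl, -⟩ := hsound w p hp
      obtain ⟨v, hv, huv⟩ := c.exists_mem_representatives (u ++ [a])
      refine ⟨Encodable.encode v, ?_⟩
      rw [NFA.evalFrom_append, NFA.evalFrom_singleton, NFA.mem_stepSet]
      exact ⟨_, hp, (c.mem_stabilizer_transitions e).2 ⟨u, hu, v, hv, huv, rfl, rfl⟩⟩
  have hacc : ∀ q, q ∈ (c.stabilizer e).toNFA.accept ↔ ∃ v ∈ c.representatives,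
      SynEq c.language (e ++ v ++ e) e ∧ Encodable.encode v = q := by
    intro q
    change q ∈ (c.stabilizer e).2.2 ↔ _
    simp only [stabilizer, List.mem_map, List.mem_filter, decide_eq_true_eq, and_assoc]
  ext w
  change w ∈ (c.stabilizer e).toNFA.accepts ↔ SynEq c.language (e ++ w ++ e) e
  rw [NFA.mem_accepts]
  have hcongr : ∀ v, SynEq c.language w v →
      SynEq c.language (e ++ w ++ e) (e ++ v ++ e) := fun v hv =>
    ((SynEq.refl e).append hv).append (.refl e)
  constructor
  · rintro ⟨q, hq, hqw⟩
    obtain ⟨v, -, hv, rfl⟩ := (hacc q).1 hq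
    obtain ⟨v', -, hvv', hwv⟩ := hsound w _ hqw
    obtain rfl := Encodable.encode_injective hvv'
    exact (hcongr v hwv).trans hv
  · intro h
    obtain ⟨q, hq⟩ := hne w
    obtain ⟨v, hv, rfl, hwv⟩ := hsound w q hq
    exact ⟨_, (hacc _).2 ⟨v, hv, (hcongr v hwv).symm.trans h, rfl⟩, hq⟩

/-- Automata for the local stabilizers of the language of `c`. -/
noncomputable def stabilizers (c : NFACode A) : List (NFACode A) :=
  open Classical in
  (c.representatives.filter fun e => SynEq c.language (e ++ e) e).map c.stabilizer

/-- Idempotency and the stabilizer depend only on the class of e, so the representatives suffice. -/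
theorem mem_Pol_inter_coPol_iff {C : Set (Language A)} (hC : IsQuotientingLatticeOfRegular C)
    (c : NFACode A) :
    c.language ∈ Pol C ∩ coPol C ↔ ∀ d ∈ c.stabilizers, d.language ∈ C := by
  rw [_root_.mem_Pol_inter_coPol_iff hC ((isRegular_iff_exists_code _).2 ⟨c, rfl⟩)]
  simp only [stabilizers, List.forall_mem_map, List.mem_filter, decide_eq_true_eq,
    language_stabilizer]
  refine ⟨fun h e he => h e he.2, fun h e he => ?_⟩
  obtain ⟨f, hf, hef⟩ := c.exists_mem_representatives e
  refine Language.mem_of_iff (h f ⟨hf, ((hef.append hef).symm.trans he).trans hef⟩) fun w => ?_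
  have := (hef.append (.refl w)).append hef
  exact ⟨fun h => (this.trans h).trans hef.symm, fun h => (this.symm.trans h).trans hef⟩

end NFACode

end Codes

/-! ### Primitive recursiveness of the construction, and the decision procedure -/

section Computability

variable {A : Type*} [Primcodable A]

theorem primrecRel_list_mem {β : Type*} [Primcodable β] :
    PrimrecRel fun (b : β) (l : List β) => b ∈ l :=
  ((Primrec.eq (α := β)).exists_mem_list.comp Primrec.snd Primrec.fst).of_eq fun p => by simp

theorem PrimrecPred.iff {α : Type*} [Primcodable α] {p q : α → Prop} (hp : PrimrecPred p)
    (hq : PrimrecPred q) : PrimrecPred fun a => p a ↔ q a :=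
  ((hp.and hq).or (hp.not.and hq.not)).of_eq fun _ => by tauto

namespace NFACode

theorem primrec_stepList :
    Primrec fun p : NFACode A × List ℕ × A => p.1.stepList p.2.1 p.2.2 := by
  classical
  have hR : PrimrecRel fun (t : ℕ × A × ℕ) (b : List ℕ × A) => t.1 ∈ b.1 ∧ t.2.1 = b.2 :=
    (primrecRel_list_mem.comp (Primrec.fst.comp Primrec.fst)
      (Primrec.fst.comp Primrec.snd)).and
      (Primrec.eq.comp (Primrec.fst.comp (Primrec.snd.comp Primrec.fst))
        (Primrec.snd.comp Primrec.snd))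
  refine (Primrec.list_map (hR.listFilter.comp (Primrec.fst.comp (Primrec.snd.comp Primrec.fst))
    Primrec.snd) (g := fun _ t => t.2.2)
    (Primrec.snd.comp (Primrec.snd.comp Primrec.snd)).to₂).of_eq fun p => ?_
  simp only [stepList]

theorem primrecRel_mem_language :
    PrimrecRel fun (w : List A) (c : NFACode A) => w ∈ c.language := by
  have hrun : Primrec fun p : List A × NFACode A => p.1.foldl p.2.stepList p.2.1 :=
    Primrec.list_foldl (h := fun (p : List A × NFACode A) (q : List ℕ × A) =>
        p.2.stepList q.1 q.2) Primrec.fst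
      (Primrec.fst.comp Primrec.snd)
      (primrec_stepList.comp
        (Primrec.pair (Primrec.snd.comp Primrec.fst) Primrec.snd)).to₂
  have := (primrecRel_list_mem (β := ℕ)).exists_mem_list
  exact (this.comp (Primrec.snd.comp (Primrec.snd.comp Primrec.snd)) hrun).of_eq
    fun p => (mem_language_iff p.2 p.1).symm

theorem primrec_bound : Primrec (bound : NFACode A → ℕ) := by
  have hpow : Primrec fun n : ℕ => 2 ^ n := by
    refine (Primrec.nat_rec₁ (f := fun _ k => k + k) 1
      (Primrec.nat_add.comp Primrec.snd Primrec.snd)).of_eq fun n => ?_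
    induction n with
    | zero => rfl
    | succ n ih => rw [pow_succ, ← ih, mul_two]
  have hlen : Primrec fun c : NFACode A => c.2.1.length :=
    Primrec.list_length.comp (Primrec.fst.comp Primrec.snd)
  exact hpow.comp (Primrec.nat_mul.comp hlen hlen)

variable [Finite A]

theorem primrec_representatives : Primrec (representatives : NFACode A → List (List A)) := by
  have hwords : Primrec (wordsUpTo A) := by
    refine (Primrec.nat_rec₁ (f := fun _ W => [] :: W.flatMap fun w =>
      (alphabetList A).map fun a => a :: w) [[]] ?_).of_eq fun n => ?_
    · refine Primrec.list_cons.comp (Primrec.const []) ?_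
      refine Primrec.list_flatMap Primrec.snd ?_
      exact Primrec.list_map (Primrec.const _)
        (Primrec.list_cons.comp Primrec.snd (Primrec.snd.comp Primrec.fst))
    · induction n with
      | zero => rfl
      | succ n ih => simp only [wordsUpTo, ← ih]
  exact hwords.comp primrec_bound

/-- By `synEq_iff`, the quantifiers over contexts range over a computable finite list. -/
theorem primrecPred_synEq :
    PrimrecPred fun p : NFACode A × List A × List A => SynEq p.1.language p.2.1 p.2.2 := by
  have h₁ : PrimrecRel fun (y : List A) (b : List A × NFACode A × List A × List A) =>
      (b.1 ++ b.2.2.1 ++ y ∈ b.2.1.language ↔ b.1 ++ b.2.2.2 ++ y ∈ b.2.1.language) := by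
    have hc : Primrec fun p : List A × List A × NFACode A × List A × List A => p.2.2.1 :=
      Primrec.fst.comp (Primrec.snd.comp Primrec.snd)
    have hx : Primrec fun p : List A × List A × NFACode A × List A × List A => p.2.1 :=
      Primrec.fst.comp Primrec.snd
    have hu : Primrec fun p : List A × List A × NFACode A × List A × List A => p.2.2.2.1 :=
      Primrec.fst.comp (Primrec.snd.comp (Primrec.snd.comp Primrec.snd))
    have hv : Primrec fun p : List A × List A × NFACode A × List A × List A => p.2.2.2.2 :=
      Primrec.snd.comp (Primrec.snd.comp (Primrec.snd.comp Primrec.snd))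
    exact (primrecRel_mem_language.comp (Primrec.list_append.comp
        (Primrec.list_append.comp hx hu) Primrec.fst) hc).iff
      (primrecRel_mem_language.comp (Primrec.list_append.comp
        (Primrec.list_append.comp hx hv) Primrec.fst) hc)
  have h₂ : PrimrecRel fun (x : List A) (b : NFACode A × List A × List A) =>
      ∀ y ∈ b.1.representatives,
        (x ++ b.2.1 ++ y ∈ b.1.language ↔ x ++ b.2.2 ++ y ∈ b.1.language) :=
    h₁.forall_mem_list.comp (primrec_representatives.comp (Primrec.fst.comp Primrec.snd))
      (Primrec.pair Primrec.fst Primrec.snd)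
  exact (h₂.forall_mem_list.comp (primrec_representatives.comp Primrec.fst) Primrec.id).of_eq
    fun p => (p.1.synEq_iff p.2.1 p.2.2).symm

theorem primrec_stabilizer : Primrec₂ (stabilizer : NFACode A → List A → NFACode A) := by
  classical
  have hR₁ : PrimrecRel fun (v : List A) (b : NFACode A × List A) => SynEq b.1.language b.2 v :=
    primrecPred_synEq.comp (Primrec.pair (Primrec.fst.comp Primrec.snd)
      (Primrec.pair (Primrec.snd.comp Primrec.snd) Primrec.fst))
  have hR₂ : PrimrecRel fun (v : List A) (b : NFACode A × List A) =>
      SynEq b.1.language (b.2 ++ v ++ b.2) b.2 :=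
    primrecPred_synEq.comp (Primrec.pair (Primrec.fst.comp Primrec.snd)
      (Primrec.pair (Primrec.list_append.comp (Primrec.list_append.comp
        (Primrec.snd.comp Primrec.snd) Primrec.fst) (Primrec.snd.comp Primrec.snd))
        (Primrec.snd.comp Primrec.snd)))
  have hW : Primrec fun p : NFACode A × List A => p.1.representatives :=
    primrec_representatives.comp Primrec.fst
  have htrans : Primrec fun p : NFACode A × List A =>
      p.1.representatives.flatMap fun u => (alphabetList A).flatMap fun a =>
        (p.1.representatives.filter fun v => SynEq p.1.language (u ++ [a]) v).map fun v =>
          (Encodable.encode u, a, Encodable.encode v) := by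
    have hfilter : Primrec fun q : ((NFACode A × List A) × List A) × A =>
        q.1.1.1.representatives.filter fun v => SynEq q.1.1.1.language (q.1.2 ++ [q.2]) v :=
      hR₁.listFilter.comp
        (g := fun q : ((NFACode A × List A) × List A) × A => q.1.1.1.representatives)
        (h := fun q => (q.1.1.1, q.1.2 ++ [q.2]))
        (hW.comp (Primrec.fst.comp Primrec.fst))
        (Primrec.pair (Primrec.fst.comp (Primrec.fst.comp Primrec.fst))
          (Primrec.list_concat.comp (Primrec.snd.comp Primrec.fst) Primrec.snd))
    have hmap : Primrec₂ fun (q : ((NFACode A × List A) × List A) × A) (v : List A) =>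
        (Encodable.encode q.1.2, q.2, Encodable.encode v) :=
      (Primrec.pair (Primrec.encode.comp (Primrec.snd.comp (Primrec.fst.comp Primrec.fst)))
        (Primrec.pair (Primrec.snd.comp Primrec.fst) (Primrec.encode.comp Primrec.snd))).to₂
    have hmid : Primrec fun q : (NFACode A × List A) × List A =>
        (alphabetList A).flatMap fun a => (q.1.1.representatives.filter fun v =>
          SynEq q.1.1.language (q.2 ++ [a]) v).map fun v =>
            (Encodable.encode q.2, a, Encodable.encode v) :=
      Primrec.list_flatMap (Primrec.const _) (Primrec.list_map hfilter hmap).to₂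
    exact Primrec.list_flatMap hW hmid.to₂
  have hacc : Primrec fun p : NFACode A × List A =>
      (p.1.representatives.filter fun v => SynEq p.1.language (p.2 ++ v ++ p.2) p.2).map
        Encodable.encode :=
    Primrec.list_map (hR₂.listFilter.comp hW Primrec.id) (Primrec.encode.comp Primrec.snd).to₂
  refine (Primrec.pair (Primrec.const [Encodable.encode ([] : List A)])
    (Primrec.pair htrans hacc)).of_eq fun p => ?_
  simp only [stabilizer]

theorem primrec_stabilizers : Primrec (stabilizers : NFACode A → List (NFACode A)) := by
  classical
  have hR : PrimrecRel fun (e : List A) (c : NFACode A) => SynEq c.language (e ++ e) e :=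
    primrecPred_synEq.comp (Primrec.pair Primrec.snd
      (Primrec.pair (Primrec.list_append.comp Primrec.fst Primrec.fst) Primrec.fst))
  refine (Primrec.list_map (hR.listFilter.comp primrec_representatives Primrec.id)
    primrec_stabilizer).of_eq fun c => ?_
  simp only [stabilizers, id]

end NFACode

/-- Since p is only computable, the primitive recursive list quantifiers do not apply; the
conjunction is accumulated by recursion on the index. -/
theorem ComputablePred.forall_mem_list {α : Type*} [Primcodable α] {p : α → Prop}
    (hp : ComputablePred p) : ComputablePred fun l : List α => ∀ a ∈ l, p a := by
  classical
  -- The default `true` is neutral and only serves out-of-range indices, which recursion up to the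
  -- length never meets.
  have hstep : Computable₂ fun (l : List α) (q : ℕ × Bool) =>
      (((l[q.1]?).map fun a => decide (p a)).getD true && q.2) :=
    (Primrec.and.to_comp).comp
      (Computable.option_getD
        (Computable.option_map (Computable.list_getElem?.comp Computable.fst
          (Computable.fst.comp Computable.snd)) (hp.decide.comp Computable.snd))
        (Computable.const true))
      (Computable.snd.comp Computable.snd)
  refine Computable.computablePred ((Computable.nat_rec Computable.list_length
    (Computable.const true) hstep).of_eq fun l => ?_)
  have key : ∀ n : ℕ, (Nat.rec true (fun i b =>
      (((l[i]?).map fun a => decide (p a)).getD true && b)) n : Bool) = true ↔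
      ∀ i < n, ∀ a, l[i]? = some a → p a := by
    intro n
    induction n with
    | zero => simp
    | succ n ih =>
      rw [Nat.forall_lt_succ_right, ← ih, and_comm]
      cases h : l[n]? <;> simp [h]
  rw [Bool.eq_iff_iff, decide_eq_true_iff]
  refine (key l.length).trans ⟨fun h a ha => ?_, fun h i _ a ha => h a (List.mem_of_getElem? ha)⟩
  obtain ⟨i, hi, rfl⟩ := List.getElem_of_mem ha
  exact h i hi _ (List.getElem?_eq_getElem hi)

end Computability

/-- A conjunctive truth-table reduction to C-membership, the queries being the stabilizer automata.
-/
theorem mainTheorem4 {A : Type*} [Finite A] [Primcodable A] (C : Set (Language A))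
    (hC : IsQuotientingLatticeOfRegular C) (hdec : MembershipDecidable C) :
    MembershipDecidable (Pol C ∩ coPol C) := by
  classical
  refine Computable.computablePred
    ((ComputablePred.decide (ComputablePred.forall_mem_list hdec)).comp
      (NFACode.primrec_stabilizers (A := A)).to_comp |>.of_eq fun c => ?_)
  exact decide_eq_decide.2 (c.mem_Pol_inter_coPol_iff hC).symm
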